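/- Let $\mathcal H$ be a complex separable Hilbert space, possibly infinite dimensional; tensor products below are Hilbert space tensor products. A bounded operator $Z\neq 0$ on $\mathcal H\otimes\mathcal H\otimes\mathcal H$ is called *tensor-positive* if $(\psi_1\otimes\psi_2\otimes\psi_3,\ Z\,\psi_1\otimes\psi_2\otimes\psi_3)\ge 0$ for all $\psi_1,\psi_2,\psi_3\in\mathcal H$. For a trace class operator $R$ on $\mathcal H\otimes\mathcal H\otimes\mathcal H$ and $k=1,2,3$, let $\mathrm{tr}^{(k)}_{\mathcal H}[R]$ denote the partial trace of $R$ over the $k$-th tensor factor, which is an operator on $\mathcal H\otimes\mathcal H$ (the tensor product of the two remaining factors in their order). **Theorem.** Let $\rho$ be a density operator (a positive trace class operator with trace $1$) on $\mathcal H\otimes\mathcal H$. Suppose that there exists a self-adjoint, trace class, tensor-positive operator $R$ on $\mathcal H\otimes\mathcal H\otimes\mathcal H$ such that $$\mathrm{tr}^{(k)}_{\mathcal H}[R]=\rho,\qquad k=1,2,3 .$$ Then $\rho$ satisfies the "perfect correlation" version of the original Bell inequality: for any three bounded self-adjoint operators $A_1,B_1,B_2$ on $\mathcal H$ with spectrum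 (of any type, discrete or continuous) contained in $[-1,1]$, the number $\mathrm{tr}[\rho(B_1\otimes B_2)]$ is real and $$\bigl|\mathrm{tr}[\rho(A_1\otimes B_1)]-\mathrm{tr}[\rho(A_1\otimes B_2)]\bigr|\le 1-\mathrm{tr}[\rho(B_1\otimes B_2)].$$ -/

import Mathlib

open scoped TensorProduct ComplexOrder InnerProductSpace

noncomputable section

namespace QBell

section HilbertTensor

variable (E F G : Type*) [NormedAddCommGroup E] [InnerProductSpace ℂ E]
  [NormedAddCommGroup F] [InnerProductSpace ℂ F] [NormedAddCommGroup G] [InnerProductSpace ℂ G]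

/-- The Hilbert space tensor product `E ⊗ F`: the completion of the algebraic tensor product for
the inner product with `⟪a ⊗ b, c ⊗ d⟫ = ⟪a, c⟫ * ⟪b, d⟫`. -/
def HTensor : Type _ := UniformSpace.Completion (E ⊗[ℂ] F)

instance : NormedAddCommGroup (HTensor E F) :=
  inferInstanceAs (NormedAddCommGroup (UniformSpace.Completion (E ⊗[ℂ] F)))

instance : InnerProductSpace ℂ (HTensor E F) :=
  inferInstanceAs (InnerProductSpace ℂ (UniformSpace.Completion (E ⊗[ℂ] F)))

instance : CompleteSpace (HTensor E F) :=
  inferInstanceAs (CompleteSpace (UniformSpace.Completion (E ⊗[ℂ] F)))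

/-- The Hilbert space tensor product `E ⊗ F ⊗ G` of three spaces, likewise. -/
def HTensor₃ : Type _ := UniformSpace.Completion (E ⊗[ℂ] F ⊗[ℂ] G)

instance : NormedAddCommGroup (HTensor₃ E F G) :=
  inferInstanceAs (NormedAddCommGroup (UniformSpace.Completion (E ⊗[ℂ] F ⊗[ℂ] G)))

instance : InnerProductSpace ℂ (HTensor₃ E F G) :=
  inferInstanceAs (InnerProductSpace ℂ (UniformSpace.Completion (E ⊗[ℂ] F ⊗[ℂ] G)))

instance : CompleteSpace (HTensor₃ E F G) :=
  inferInstanceAs (CompleteSpace (UniformSpace.Completion (E ⊗[ℂ] F ⊗[ℂ] G)))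

end HilbertTensor

section Trace

variable {K : Type*} [NormedAddCommGroup K] [InnerProductSpace ℂ K]

/-- Trace class operators: the bounded operators of the form `T v = ∑ n, ⟪x n, v⟫ • y n` with
`∑ n, ‖x n‖ * ‖y n‖ < ∞`. -/
def IsTraceClass (T : K →L[ℂ] K) : Prop :=
  ∃ x y : ℕ → K, Summable (fun n => ‖x n‖ * ‖y n‖) ∧
    ∀ v : K, HasSum (fun n => ⟪x n, v⟫_ℂ • y n) (T v)

variable [CompleteSpace K]

variable (K) in
/-- The index set of a chosen orthonormal basis of the Hilbert space `K`. -/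
def basisIndex : Set K := (exists_hilbertBasis ℂ K).choose

variable (K) in
/-- A chosen orthonormal basis of the Hilbert space `K`. -/
def onb : HilbertBasis (basisIndex K) ℂ K := (exists_hilbertBasis ℂ K).choose_spec.choose

/-- The trace `tr[T] = ∑ i, ⟪e i, T (e i)⟫` over an orthonormal basis `e`; for a trace class
operator the sum converges absolutely and does not depend on the basis. -/
def trace (T : K →L[ℂ] K) : ℂ := ∑' i, ⟪onb K i, T (onb K i)⟫_ℂ

/-- Density operators (quantum states): positive trace class operators with trace one. -/
structure IsDensityOperator (ρ : K →L[ℂ] K) : Prop where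
  isPositive : ρ.IsPositive
  isTraceClass : IsTraceClass ρ
  trace_eq_one : trace ρ = 1

/-- Bounded observables with spectrum (of any type) in `[-1, 1]`. -/
structure IsObservable (A : K →L[ℂ] K) : Prop where
  isSelfAdjoint : IsSelfAdjoint A
  spectrum_subset : spectrum ℂ A ⊆ Complex.ofReal '' Set.Icc (-1) 1

end Trace

section Tensor

variable {E F G : Type*} [NormedAddCommGroup E] [InnerProductSpace ℂ E]
  [NormedAddCommGroup F] [InnerProductSpace ℂ F] [NormedAddCommGroup G] [InnerProductSpace ℂ G]

/-- The product vector `x ⊗ y` in `E ⊗ F`. -/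
def pure₂ (x : E) (y : F) : HTensor E F :=
  ((x ⊗ₜ[ℂ] y : E ⊗[ℂ] F) : UniformSpace.Completion (E ⊗[ℂ] F))

/-- The product vector `x ⊗ y ⊗ z` in `E ⊗ F ⊗ G`. -/
def pure₃ (x : E) (y : F) (z : G) : HTensor₃ E F G :=
  ((x ⊗ₜ[ℂ] y ⊗ₜ[ℂ] z : E ⊗[ℂ] F ⊗[ℂ] G) : UniformSpace.Completion (E ⊗[ℂ] F ⊗[ℂ] G))

theorem inner_pure₂ (x x' : E) (y y' : F) :
    ⟪pure₂ x y, pure₂ x' y'⟫_ℂ = ⟪x, x'⟫_ℂ * ⟪y, y'⟫_ℂ :=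
  (UniformSpace.Completion.inner_coe _ _).trans (by simp)

theorem inner_pure₃ (x x' : E) (y y' : F) (z z' : G) :
    ⟪pure₃ x y z, pure₃ x' y' z'⟫_ℂ = ⟪x, x'⟫_ℂ * ⟪y, y'⟫_ℂ * ⟪z, z'⟫_ℂ :=
  (UniformSpace.Completion.inner_coe _ _).trans (by simp)

/-- The bounded operator `A ⊗ B` on `E ⊗ F`. -/
def tensorOp (A : E →L[ℂ] E) (B : F →L[ℂ] F) : HTensor E F →L[ℂ] HTensor E F :=
  (TensorProduct.mapL A B).completion

theorem tensorOp_pure₂ (A : E →L[ℂ] E) (B : F →L[ℂ] F) (x : E) (y : F) :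
    tensorOp A B (pure₂ x y) = pure₂ (A x) (B y) :=
  ContinuousLinearMap.completion_apply_coe _ _

/-- Tensor-positivity of a bounded operator: it is nonzero and its quadratic form is (real and)
nonnegative on product vectors. -/
def IsTensorPositive (Z : HTensor₃ E F G →L[ℂ] HTensor₃ E F G) : Prop :=
  Z ≠ 0 ∧ ∀ (x : E) (y : F) (z : G), 0 ≤ ⟪pure₃ x y z, Z (pure₃ x y z)⟫_ℂ

/-- The bounded operator `F ⊗ G → E ⊗ F ⊗ G`, `y ⊗ z ↦ e ⊗ y ⊗ z`. -/
def insert₁ (e : E) : HTensor F G →L[ℂ] HTensor₃ E F G :=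
  ((TensorProduct.assocIsometry ℂ E F G).symm.toLinearIsometry.toContinuousLinearMap ∘L
    TensorProduct.mkL ℂ E (F ⊗[ℂ] G) e).completion

/-- The bounded operator `E ⊗ G → E ⊗ F ⊗ G`, `x ⊗ z ↦ x ⊗ e ⊗ z`. -/
def insert₂ (e : F) : HTensor E G →L[ℂ] HTensor₃ E F G :=
  (((TensorProduct.mkL ℂ E F).flip e).rTensor G).completion

/-- The bounded operator `E ⊗ F → E ⊗ F ⊗ G`, `x ⊗ y ↦ x ⊗ y ⊗ e`. -/
def insert₃ (e : G) : HTensor E F →L[ℂ] HTensor₃ E F G :=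
  ((TensorProduct.mkL ℂ (E ⊗[ℂ] F) G).flip e).completion

theorem insert₁_pure₂ (e : E) (y : F) (z : G) : insert₁ e (pure₂ y z) = pure₃ e y z :=
  ContinuousLinearMap.completion_apply_coe _ _

theorem insert₂_pure₂ (e : F) (x : E) (z : G) : insert₂ e (pure₂ x z) = pure₃ x e z :=
  ContinuousLinearMap.completion_apply_coe _ _

theorem insert₃_pure₂ (e : G) (x : E) (y : F) : insert₃ e (pure₂ x y) = pure₃ x y e :=
  ContinuousLinearMap.completion_apply_coe _ _

/- The partial traces: the operator `S` with `⟪u, S v⟫ = ∑ i, ⟪u ⊗ e i, T (v ⊗ e i)⟫`, where the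
elements `e i` of an orthonormal basis stand in the place that is traced out. For a trace class
operator the series of operators below converges absolutely in operator norm. -/

/-- The partial trace over the first factor. -/
def partialTrace₁ [CompleteSpace E] (T : HTensor₃ E F G →L[ℂ] HTensor₃ E F G) :
    HTensor F G →L[ℂ] HTensor F G :=
  ∑' i, (insert₁ (onb E i)).adjoint ∘L T ∘L insert₁ (onb E i)

/-- The partial trace over the second factor. -/
def partialTrace₂ [CompleteSpace F] (T : HTensor₃ E F G →L[ℂ] HTensor₃ E F G) :
    HTensor E G →L[ℂ] HTensor E G :=
  ∑' i, (insert₂ (onb F i)).adjoint ∘L T ∘L insert₂ (onb F i)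

/-- The partial trace over the third factor. -/
def partialTrace₃ [CompleteSpace G] (T : HTensor₃ E F G →L[ℂ] HTensor₃ E F G) :
    HTensor E F →L[ℂ] HTensor E F :=
  ∑' i, (insert₃ (onb G i)).adjoint ∘L T ∘L insert₃ (onb G i)

end Tensor

end QBell

end

/-! The inequality comes from a polynomial identity. For commuting `a`, `b`, `c`, the sum
`(1+a)(1+b)(1+c) + (1-a)(1-b)(1-c)` equals `2(1 + ab + ac + bc)`, since the odd terms cancel. Let `a
= ±A₁`, `b = B₁`, `c = -B₂` act on the first, second and third factors. All `1 ± A₁`, `1 ± B₁`, `1 ±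
B₂` are positive operators, so pairing with `R` gives nonnegative numbers
(`trace_comp_tensorOp₃_nonneg`). Each surviving term acts trivially on one factor, so its trace
against `R` is a trace against the corresponding partial trace, which is `ρ`
(`IsTraceClass.trace_tsum_comp`). The two signs of `A₁` then bound the difference of correlations
from both sides.

In infinite dimension the work lies in the series: basis independence and cyclicity of the trace,
and convergence of the partial traces, follow from the rank one expansion by Cauchy–Schwarz, Bessel
and Fubini. -/

noncomputable section

namespace QBell

/-! ### Trace class operators and their trace -/

section Abstract

variable {K L : Type*} [NormedAddCommGroup K] [InnerProductSpace ℂ K]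
  [NormedAddCommGroup L] [InnerProductSpace ℂ L]

/-- The operator `T` is the weak sum of the rank one operators `v ↦ ⟪x n, v⟫ • y n`, and these are
absolutely summable in norm. -/
structure IsRankOneSum (T : K →L[ℂ] K) (x y : ℕ → K) : Prop where
  summable : Summable fun n => ‖x n‖ * ‖y n‖
  hasSum : ∀ v : K, HasSum (fun n => ⟪x n, v⟫_ℂ • y n) (T v)

theorem IsRankOneSum.norm_le {T : K →L[ℂ] K} {x y : ℕ → K} (h : IsRankOneSum T x y) :
    ‖T‖ ≤ ∑' n, ‖x n‖ * ‖y n‖ := by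
  refine T.opNorm_le_bound (tsum_nonneg fun n => by positivity) fun v => ?_
  refine (h.hasSum v).norm_le_of_bounded (h.summable.hasSum.mul_right ‖v‖) fun n => ?_
  rw [norm_smul]
  calc ‖⟪x n, v⟫_ℂ‖ * ‖y n‖ ≤ ‖x n‖ * ‖v‖ * ‖y n‖ := by gcongr; exact norm_inner_le_norm _ _
    _ = _ := by ring

theorem IsRankOneSum.comp_comp [CompleteSpace K] [CompleteSpace L] {T : K →L[ℂ] K} {x y : ℕ → K}
    (h : IsRankOneSum T x y) (A : K →L[ℂ] L) (B : L →L[ℂ] K) :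
    IsRankOneSum (A ∘L T ∘L B) (fun n => B.adjoint (x n)) (fun n => A (y n)) where
  summable := by
    refine Summable.of_nonneg_of_le (fun n => by positivity) (fun n => ?_)
      (h.summable.mul_left (‖B.adjoint‖ * ‖A‖))
    calc ‖B.adjoint (x n)‖ * ‖A (y n)‖ ≤ (‖B.adjoint‖ * ‖x n‖) * (‖A‖ * ‖y n‖) := by
          gcongr <;> exact ContinuousLinearMap.le_opNorm _ _
      _ = _ := by ring
  hasSum v := by
    simpa [ContinuousLinearMap.adjoint_inner_left] using (h.hasSum (B v)).mapL A

theorem summable_prod_of_sum_le {ι : Type*} {u : ℕ → ι → ℝ} {c : ℕ → ℝ} (hu : ∀ n i, 0 ≤ u n i)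
    (hc : Summable c) (h : ∀ n (s : Finset ι), ∑ i ∈ s, u n i ≤ c n) :
    Summable fun p : ℕ × ι => u p.1 p.2 := by
  have h1 : ∀ n, Summable (u n) := fun n => summable_of_sum_le (hu n) (h n)
  refine (summable_prod_of_nonneg fun p => hu p.1 p.2).2 ⟨h1, ?_⟩
  exact Summable.of_nonneg_of_le (fun n => tsum_nonneg (hu n))
    (fun n => (h1 n).tsum_le_of_sum_le (h n)) hc

theorem sum_mul_le_of_sum_sq_le {ι : Type*} {f g : ι → ℝ} {a b : ℝ} (ha : 0 ≤ a) (hb : 0 ≤ b)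
    (s : Finset ι) (hf : ∑ i ∈ s, f i ^ 2 ≤ a ^ 2) (hg : ∑ i ∈ s, g i ^ 2 ≤ b ^ 2) :
    ∑ i ∈ s, f i * g i ≤ a * b := by
  refine (Real.sum_mul_le_sqrt_mul_sqrt s f g).trans ?_
  gcongr
  · exact (Real.sqrt_le_left ha).2 hf
  · exact (Real.sqrt_le_left hb).2 hg

theorem hasSum_norm_inner_sq {ι : Type*} (b : HilbertBasis ι ℂ K) (v : K) :
    HasSum (fun i => ‖⟪b i, v⟫_ℂ‖ ^ 2) (‖v‖ ^ 2) := by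
  have h := b.hasSum_inner_mul_inner v v
  rw [← Complex.hasSum_ofReal]
  convert! h using 1
  · ext i
    rw [← inner_conj_symm v (b i), Complex.conj_mul', Complex.ofReal_pow]
  · rw [inner_self_eq_norm_sq_to_K]; simp

/-- The trace of an operator may be computed in any Hilbert basis. -/
theorem IsRankOneSum.hasSum_inner {ι : Type*} {T : K →L[ℂ] K} {x y : ℕ → K}
    (h : IsRankOneSum T x y) (b : HilbertBasis ι ℂ K) :
    HasSum (fun i => ⟪b i, T (b i)⟫_ℂ) (∑' n, ⟪x n, y n⟫_ℂ) := by
  -- For fixed `n`, Cauchy–Schwarz and Bessel bound the sum over the basis by `‖x n‖ * ‖y n‖`; the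
  -- double series is therefore absolutely summable and may be summed in either order.
  have hs : Summable fun p : ℕ × ι => ⟪x p.1, b p.2⟫_ℂ * ⟪b p.2, y p.1⟫_ℂ := by
    refine Summable.of_norm ?_
    simp only [norm_mul]
    refine summable_prod_of_sum_le (u := fun n i => ‖⟪x n, b i⟫_ℂ‖ * ‖⟪b i, y n⟫_ℂ‖)
      (fun n i => by positivity) h.summable fun n s => ?_
    refine sum_mul_le_of_sum_sq_le (norm_nonneg _) (norm_nonneg _) s ?_ ?_
    · simp_rw [norm_inner_symm (x n)]
      exact b.orthonormal.sum_inner_products_le (x n)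
    · exact b.orthonormal.sum_inner_products_le (y n)
  have h1 := hs.hasSum.prod_fiberwise fun n => b.hasSum_inner_mul_inner (x n) (y n)
  rw [h1.tsum_eq]
  refine ((Equiv.prodComm ι ℕ).hasSum_iff.2 hs.hasSum).prod_fiberwise fun i => ?_
  have := (h.hasSum (b i)).mapL (innerSL ℂ (b i))
  simpa [inner_smul_right] using this

theorem IsRankOneSum.hasSum_inner_trace [CompleteSpace K] {ι : Type*} {T : K →L[ℂ] K} {x y : ℕ → K}
    (h : IsRankOneSum T x y) (b : HilbertBasis ι ℂ K) :
    HasSum (fun i => ⟪b i, T (b i)⟫_ℂ) (trace T) := by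
  rw [trace, (h.hasSum_inner (onb K)).tsum_eq]
  exact h.hasSum_inner b

theorem IsRankOneSum.trace_eq [CompleteSpace K] {T : K →L[ℂ] K} {x y : ℕ → K}
    (h : IsRankOneSum T x y) : trace T = ∑' n, ⟪x n, y n⟫_ℂ :=
  (h.hasSum_inner (onb K)).tsum_eq

theorem IsTraceClass.exists_isRankOneSum {T : K →L[ℂ] K} (h : IsTraceClass T) :
    ∃ x y, IsRankOneSum T x y :=
  let ⟨x, y, h1, h2⟩ := h; ⟨x, y, h1, h2⟩

theorem IsTraceClass.comp_comp [CompleteSpace K] [CompleteSpace L] {T : K →L[ℂ] K}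
    (h : IsTraceClass T) (A : K →L[ℂ] L) (B : L →L[ℂ] K) : IsTraceClass (A ∘L T ∘L B) :=
  let ⟨_, _, h⟩ := h.exists_isRankOneSum
  ⟨_, _, (h.comp_comp A B).summable, (h.comp_comp A B).hasSum⟩

theorem IsTraceClass.comp_right [CompleteSpace K] {T : K →L[ℂ] K}
    (h : IsTraceClass T) (S : K →L[ℂ] K) : IsTraceClass (T ∘L S) :=
  h.comp_comp (.id ℂ K) S

theorem IsTraceClass.hasSum_trace [CompleteSpace K] {ι : Type*} {T : K →L[ℂ] K}
    (h : IsTraceClass T) (b : HilbertBasis ι ℂ K) :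
    HasSum (fun i => ⟪b i, T (b i)⟫_ℂ) (trace T) :=
  let ⟨_, _, h⟩ := h.exists_isRankOneSum
  h.hasSum_inner_trace b

/-- Cyclicity of the trace. -/
theorem IsTraceClass.trace_comp_comp [CompleteSpace K] {T : K →L[ℂ] K} (h : IsTraceClass T)
    (A B : K →L[ℂ] K) : trace (A ∘L T ∘L B) = trace (T ∘L (B ∘L A)) := by
  obtain ⟨x, y, h⟩ := h.exists_isRankOneSum
  have h2 := (h.comp_comp (.id ℂ K) (B ∘L A)).trace_eq
  rw [ContinuousLinearMap.id_comp] at h2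
  rw [(h.comp_comp A B).trace_eq, h2]
  -- Termwise, both sides are `⟪x n, B (A (y n))⟫`.
  refine tsum_congr fun n => ?_
  simp [ContinuousLinearMap.adjoint_inner_left]

theorem IsTraceClass.trace_comp_add [CompleteSpace K] {T : K →L[ℂ] K} (h : IsTraceClass T)
    (A B : K →L[ℂ] K) : trace (T ∘L (A + B)) = trace (T ∘L A) + trace (T ∘L B) := by
  rw [← ((h.comp_right (A + B)).hasSum_trace (onb K)).tsum_eq]
  refine HasSum.tsum_eq ?_
  simpa [inner_add_right] using
    ((h.comp_right A).hasSum_trace (onb K)).add ((h.comp_right B).hasSum_trace (onb K))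

theorem IsTraceClass.trace_comp_sub [CompleteSpace K] {T : K →L[ℂ] K} (h : IsTraceClass T)
    (A B : K →L[ℂ] K) : trace (T ∘L (A - B)) = trace (T ∘L A) - trace (T ∘L B) := by
  have := h.trace_comp_add (A - B) B
  rw [sub_add_cancel] at this
  rw [this, add_sub_cancel_right]

/-! ### Partial traces along isometries with orthogonal, jointly total ranges -/

section Inclusions

variable [CompleteSpace K] [CompleteSpace L] {ι κ : Type*} [DecidableEq ι] {J : ι → L →L[ℂ] K}

/-- A Hilbert basis of a Hilbert sum, from a Hilbert basis of the summands. -/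
theorem exists_hilbertBasis_of_inclusions
    (hJ : ∀ i j u v, ⟪J i u, J j v⟫_ℂ = if i = j then ⟪u, v⟫_ℂ else 0)
    (htot : ∀ v, (∀ i u, ⟪J i u, v⟫_ℂ = 0) → v = 0) (b : HilbertBasis κ ℂ L) :
    ∃ c : HilbertBasis (ι × κ) ℂ K, ∀ p, c p = J p.1 (b p.2) := by
  classical
  have ho : Orthonormal ℂ fun p : ι × κ => J p.1 (b p.2) := by
    rw [orthonormal_iff_ite]
    rintro ⟨i, k⟩ ⟨j, l⟩
    simp only [hJ, orthonormal_iff_ite.1 b.orthonormal, Prod.mk.injEq]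
    split_ifs <;> simp_all
  refine ⟨HilbertBasis.mkOfOrthogonalEqBot ho ?_,
    congrFun (HilbertBasis.coe_mkOfOrthogonalEqBot ho _)⟩
  rw [Submodule.eq_bot_iff]
  intro v hv
  refine htot v fun i => ?_
  -- All coordinates of this vector in the basis `b` vanish, so Parseval makes its norm zero.
  have h0 : (J i).adjoint v = 0 := by
    have h1 := hasSum_norm_inner_sq b ((J i).adjoint v)
    have h2 : ∀ k, ⟪b k, (J i).adjoint v⟫_ℂ = 0 := fun k => by
      rw [ContinuousLinearMap.adjoint_inner_right]
      exact hv _ (Submodule.subset_span ⟨(i, k), rfl⟩)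
    simp only [h2, norm_zero, ne_eq, OfNat.ofNat_ne_zero, not_false_eq_true, zero_pow] at h1
    simpa using h1.unique hasSum_zero
  intro u
  rw [← ContinuousLinearMap.adjoint_inner_right, h0, inner_zero_right]

theorem sum_norm_adjoint_sq_le
    (hJ : ∀ i j u v, ⟪J i u, J j v⟫_ℂ = if i = j then ⟪u, v⟫_ℂ else 0)
    (htot : ∀ v, (∀ i u, ⟪J i u, v⟫_ℂ = 0) → v = 0) (v : K) (s : Finset ι) :
    ∑ i ∈ s, ‖(J i).adjoint v‖ ^ 2 ≤ ‖v‖ ^ 2 := by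
  obtain ⟨c, hc⟩ := exists_hilbertBasis_of_inclusions hJ htot (onb L)
  refine sum_le_hasSum s (fun i _ => by positivity)
    ((hasSum_norm_inner_sq c v).prod_fiberwise fun i => ?_)
  simpa only [hc, ContinuousLinearMap.adjoint_inner_right]
    using hasSum_norm_inner_sq (onb L) ((J i).adjoint v)

/-- Each summand has norm at most `∑ n, ‖(J i)* x n‖ * ‖(J i)* y n‖`, and these bounds are summable
over `i` by Cauchy–Schwarz. Without summability the `tsum` defining a partial trace would be the
default value `0`. -/
theorem IsTraceClass.summable_adjoint_comp_comp {R : K →L[ℂ] K} (hR : IsTraceClass R)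
    (hJ : ∀ i j u v, ⟪J i u, J j v⟫_ℂ = if i = j then ⟪u, v⟫_ℂ else 0)
    (htot : ∀ v, (∀ i u, ⟪J i u, v⟫_ℂ = 0) → v = 0) :
    Summable fun i => (J i).adjoint ∘L R ∘L J i := by
  obtain ⟨x, y, h⟩ := hR.exists_isRankOneSum
  have hs : Summable fun p : ℕ × ι => ‖(J p.2).adjoint (x p.1)‖ * ‖(J p.2).adjoint (y p.1)‖ :=
    summable_prod_of_sum_le (u := fun n i => ‖(J i).adjoint (x n)‖ * ‖(J i).adjoint (y n)‖)
      (fun n i => by positivity) h.summable fun n s =>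
      sum_mul_le_of_sum_sq_le (norm_nonneg _) (norm_nonneg _) s
        (sum_norm_adjoint_sq_le hJ htot _ s) (sum_norm_adjoint_sq_le hJ htot _ s)
  have hs' := ((Equiv.prodComm ι ℕ).summable_iff.2 hs).prod
  exact Summable.of_norm_bounded hs' fun i => (h.comp_comp (J i).adjoint (J i)).norm_le

/-- The trace of a partial trace. -/
theorem IsTraceClass.trace_tsum_comp {R : K →L[ℂ] K} (hR : IsTraceClass R)
    (hJ : ∀ i j u v, ⟪J i u, J j v⟫_ℂ = if i = j then ⟪u, v⟫_ℂ else 0)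
    (htot : ∀ v, (∀ i u, ⟪J i u, v⟫_ℂ = 0) → v = 0) {S : L →L[ℂ] L} {S' : K →L[ℂ] K}
    (hS : ∀ i, S' ∘L J i = J i ∘L S) :
    trace ((∑' i, (J i).adjoint ∘L R ∘L J i) ∘L S) = trace (R ∘L S') := by
  obtain ⟨c, hc⟩ := exists_hilbertBasis_of_inclusions hJ htot (onb L)
  -- The trace over `K` is taken in the basis `J i (b k)`. Summing over `i` first, with `k` fixed,
  -- produces the diagonal entry of the partial trace, because `S'` passes through `J i` as `S`.
  have h1 := (Equiv.prodComm _ _).hasSum_iff.2 ((hR.comp_right S').hasSum_trace c)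
  refine (h1.prod_fiberwise fun k => ?_).tsum_eq
  have h2 := (hR.summable_adjoint_comp_comp hJ htot).hasSum.mapL
    (innerSL ℂ (onb L k) ∘L ContinuousLinearMap.apply ℂ L (S (onb L k)))
  convert! h2 using 1
  ext i
  have := congrArg (fun T : L →L[ℂ] K => T (onb L k)) (hS i)
  simp only [ContinuousLinearMap.comp_apply] at this
  simp [hc, this, ContinuousLinearMap.adjoint_inner_right]

end Inclusions

end Abstract

/-! ### Operators and bases on Hilbert tensor products -/

section Density

variable {E F G : Type*} [NormedAddCommGroup E] [InnerProductSpace ℂ E]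
  [NormedAddCommGroup F] [InnerProductSpace ℂ F] [NormedAddCommGroup G] [InnerProductSpace ℂ G]

theorem clm_ext_pure₂ {M : Type*} [NormedAddCommGroup M] [NormedSpace ℂ M]
    {S T : HTensor E F →L[ℂ] M} (h : ∀ x y, S (pure₂ x y) = T (pure₂ x y)) : S = T := by
  refine DFunLike.coe_injective (UniformSpace.Completion.ext S.continuous T.continuous fun a => ?_)
  have : (S ∘L (UniformSpace.Completion.toComplL : E ⊗[ℂ] F →L[ℂ] HTensor E F)).toLinearMap =
      (T ∘L (UniformSpace.Completion.toComplL : E ⊗[ℂ] F →L[ℂ] HTensor E F)).toLinearMap :=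
    TensorProduct.ext' h
  exact congrArg (fun f => f a) this

theorem ext_inner_pure₂ {v w : HTensor E F}
    (h : ∀ x y, ⟪v, pure₂ x y⟫_ℂ = ⟪w, pure₂ x y⟫_ℂ) : v = w := by
  have : innerSL ℂ v = innerSL ℂ w := clm_ext_pure₂ h
  exact ext_inner_right ℂ fun u => congrArg (fun f => f u) this

theorem clm_ext_hilbertBasis {M ι : Type*} [NormedAddCommGroup M] [NormedSpace ℂ M]
    (b : HilbertBasis ι ℂ E) {S T : E →L[ℂ] M} (h : ∀ i, S (b i) = T (b i)) : S = T := by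
  refine ContinuousLinearMap.ext_on (s := Set.range b) ?_ ?_
  · exact Submodule.dense_iff_topologicalClosure_eq_top.2 b.dense_span
  · rintro _ ⟨i, rfl⟩; exact h i

/-- `y ↦ x ⊗ y` -/
def pureCLM₂ (x : E) : F →L[ℂ] HTensor E F :=
  UniformSpace.Completion.toComplL ∘L TensorProduct.mkL ℂ E F x

/-- `x ↦ x ⊗ y` -/
def pureFlipCLM₂ (y : F) : E →L[ℂ] HTensor E F :=
  UniformSpace.Completion.toComplL ∘L (TensorProduct.mkL ℂ E F).flip y

theorem pureCLM₂_apply (x : E) (y : F) : pureCLM₂ x y = pure₂ x y := rfl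

theorem pureFlipCLM₂_apply (x : E) (y : F) : pureFlipCLM₂ y x = pure₂ x y := rfl

theorem clm_ext_pure₃ {M : Type*} [NormedAddCommGroup M] [NormedSpace ℂ M]
    {S T : HTensor₃ E F G →L[ℂ] M} (h : ∀ x y z, S (pure₃ x y z) = T (pure₃ x y z)) : S = T := by
  -- `HTensor₃ E F G` unfolds to `HTensor (E ⊗[ℂ] F) G`, so the two-factor result applies with an
  -- incomplete first factor.
  refine clm_ext_pure₂ (E := E ⊗[ℂ] F) (F := G) (S := S) (T := T) fun t z => ?_
  have : ((show HTensor (E ⊗[ℂ] F) G →L[ℂ] M from S) ∘L pureFlipCLM₂ z).toLinearMap =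
      ((show HTensor (E ⊗[ℂ] F) G →L[ℂ] M from T) ∘L pureFlipCLM₂ z).toLinearMap :=
    TensorProduct.ext' fun x y => h x y z
  exact congrArg (fun f => f t) this

theorem ext_inner_pure₃ {v w : HTensor₃ E F G}
    (h : ∀ x y z, ⟪v, pure₃ x y z⟫_ℂ = ⟪w, pure₃ x y z⟫_ℂ) : v = w := by
  have : innerSL ℂ v = innerSL ℂ w := clm_ext_pure₃ h
  exact ext_inner_right ℂ fun u => congrArg (fun f => f u) this

/-- `x ↦ x ⊗ y ⊗ z` -/
def pureCLM₃₁ (y : F) (z : G) : E →L[ℂ] HTensor₃ E F G := insert₃ z ∘L pureFlipCLM₂ y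

/-- `y ↦ x ⊗ y ⊗ z` -/
def pureCLM₃₂ (x : E) (z : G) : F →L[ℂ] HTensor₃ E F G := insert₃ z ∘L pureCLM₂ x

/-- `z ↦ x ⊗ y ⊗ z` -/
def pureCLM₃₃ (x : E) (y : F) : G →L[ℂ] HTensor₃ E F G := insert₁ x ∘L pureCLM₂ y

theorem pureCLM₃₁_apply (x : E) (y : F) (z : G) : pureCLM₃₁ y z x = pure₃ x y z :=
  insert₃_pure₂ z x y

theorem pureCLM₃₂_apply (x : E) (y : F) (z : G) : pureCLM₃₂ x z y = pure₃ x y z :=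
  insert₃_pure₂ z x y

theorem pureCLM₃₃_apply (x : E) (y : F) (z : G) : pureCLM₃₃ x y z = pure₃ x y z :=
  insert₁_pure₂ x y z

/-- The bounded operator `A ⊗ B ⊗ C` on `E ⊗ F ⊗ G`. -/
def tensorOp₃ (A : E →L[ℂ] E) (B : F →L[ℂ] F) (C : G →L[ℂ] G) :
    HTensor₃ E F G →L[ℂ] HTensor₃ E F G :=
  (TensorProduct.mapL (TensorProduct.mapL A B) C).completion

theorem tensorOp₃_pure₃ (A : E →L[ℂ] E) (B : F →L[ℂ] F) (C : G →L[ℂ] G) (x : E) (y : F) (z : G) :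
    tensorOp₃ A B C (pure₃ x y z) = pure₃ (A x) (B y) (C z) :=
  ContinuousLinearMap.completion_apply_coe _ _

theorem tensorOp₃_comp_insert₁ (B : F →L[ℂ] F) (C : G →L[ℂ] G) (e : E) :
    tensorOp₃ 1 B C ∘L insert₁ e = insert₁ e ∘L tensorOp B C :=
  clm_ext_pure₂ fun x y => by simp [insert₁_pure₂, tensorOp₃_pure₃, tensorOp_pure₂]

theorem tensorOp₃_comp_insert₂ (A : E →L[ℂ] E) (C : G →L[ℂ] G) (e : F) :
    tensorOp₃ A 1 C ∘L insert₂ e = insert₂ e ∘L tensorOp A C :=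
  clm_ext_pure₂ fun x y => by simp [insert₂_pure₂, tensorOp₃_pure₃, tensorOp_pure₂]

theorem tensorOp₃_comp_insert₃ (A : E →L[ℂ] E) (B : F →L[ℂ] F) (e : G) :
    tensorOp₃ A B 1 ∘L insert₃ e = insert₃ e ∘L tensorOp A B :=
  clm_ext_pure₂ fun x y => by simp [insert₃_pure₂, tensorOp₃_pure₃, tensorOp_pure₂]

theorem tensorOp₃_add_left (A A' : E →L[ℂ] E) (B : F →L[ℂ] F) (C : G →L[ℂ] G) :
    tensorOp₃ (A + A') B C = tensorOp₃ A B C + tensorOp₃ A' B C :=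
  clm_ext_pure₃ fun x y z => by
    simp only [tensorOp₃_pure₃, add_apply]; simp only [← pureCLM₃₁_apply, map_add]

theorem tensorOp₃_sub_left (A A' : E →L[ℂ] E) (B : F →L[ℂ] F) (C : G →L[ℂ] G) :
    tensorOp₃ (A - A') B C = tensorOp₃ A B C - tensorOp₃ A' B C :=
  clm_ext_pure₃ fun x y z => by
    simp only [tensorOp₃_pure₃, sub_apply]; simp only [← pureCLM₃₁_apply, map_sub]

theorem tensorOp₃_add_middle (A : E →L[ℂ] E) (B B' : F →L[ℂ] F) (C : G →L[ℂ] G) :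
    tensorOp₃ A (B + B') C = tensorOp₃ A B C + tensorOp₃ A B' C :=
  clm_ext_pure₃ fun x y z => by
    simp only [tensorOp₃_pure₃, add_apply]; simp only [← pureCLM₃₂_apply, map_add]

theorem tensorOp₃_sub_middle (A : E →L[ℂ] E) (B B' : F →L[ℂ] F) (C : G →L[ℂ] G) :
    tensorOp₃ A (B - B') C = tensorOp₃ A B C - tensorOp₃ A B' C :=
  clm_ext_pure₃ fun x y z => by
    simp only [tensorOp₃_pure₃, sub_apply]; simp only [← pureCLM₃₂_apply, map_sub]

theorem tensorOp₃_add_right (A : E →L[ℂ] E) (B : F →L[ℂ] F) (C C' : G →L[ℂ] G) :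
    tensorOp₃ A B (C + C') = tensorOp₃ A B C + tensorOp₃ A B C' :=
  clm_ext_pure₃ fun x y z => by
    simp only [tensorOp₃_pure₃, add_apply]; simp only [← pureCLM₃₃_apply, map_add]

theorem tensorOp₃_sub_right (A : E →L[ℂ] E) (B : F →L[ℂ] F) (C C' : G →L[ℂ] G) :
    tensorOp₃ A B (C - C') = tensorOp₃ A B C - tensorOp₃ A B C' :=
  clm_ext_pure₃ fun x y z => by
    simp only [tensorOp₃_pure₃, sub_apply]; simp only [← pureCLM₃₃_apply, map_sub]

theorem tensorOp₃_mul (A A' : E →L[ℂ] E) (B B' : F →L[ℂ] F) (C C' : G →L[ℂ] G) :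
    tensorOp₃ (A * A') (B * B') (C * C') = tensorOp₃ A B C ∘L tensorOp₃ A' B' C' :=
  clm_ext_pure₃ fun x y z => by simp [tensorOp₃_pure₃]

theorem adjoint_tensorOp₃ [CompleteSpace E] [CompleteSpace F] [CompleteSpace G]
    (A : E →L[ℂ] E) (B : F →L[ℂ] F) (C : G →L[ℂ] G) :
    (tensorOp₃ A B C).adjoint = tensorOp₃ A.adjoint B.adjoint C.adjoint :=
  clm_ext_pure₃ fun x y z => ext_inner_pure₃ fun x' y' z' => by
    simp [ContinuousLinearMap.adjoint_inner_left, tensorOp₃_pure₃, inner_pure₃]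

/-- A relation between inner products that holds on product vectors holds everywhere. -/
theorem inner_map_eq_of_pure₂ {M : Type*} [NormedAddCommGroup M] [InnerProductSpace ℂ M]
    [CompleteSpace M] {S T : HTensor E F →L[ℂ] M} {c : ℂ}
    (h : ∀ x y x' y', ⟪S (pure₂ x y), T (pure₂ x' y')⟫_ℂ = c * ⟪pure₂ x y, pure₂ x' y'⟫_ℂ)
    (u v : HTensor E F) : ⟪S u, T v⟫_ℂ = c * ⟪u, v⟫_ℂ := by
  -- The relation says that `T* S` is the scalar `star c`, conjugated because the inner product is
  -- conjugate-linear on the left.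
  have key : T.adjoint ∘L S = star c • ContinuousLinearMap.id ℂ (HTensor E F) :=
    clm_ext_pure₂ fun x y => ext_inner_pure₂ fun x' y' => by
      simp [ContinuousLinearMap.adjoint_inner_left, h, mul_comm]
  have := congrArg (fun f => ⟪f u, v⟫_ℂ) key
  simpa [ContinuousLinearMap.adjoint_inner_left, inner_smul_left, mul_comm] using this

theorem inner_insert₁ (e e' : E) (u v : HTensor F G) :
    ⟪insert₁ e u, insert₁ e' v⟫_ℂ = ⟪e, e'⟫_ℂ * ⟪u, v⟫_ℂ :=
  inner_map_eq_of_pure₂ (fun x y x' y' => by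
    rw [insert₁_pure₂, insert₁_pure₂, inner_pure₃, inner_pure₂]; ring) u v

theorem inner_insert₂ (e e' : F) (u v : HTensor E G) :
    ⟪insert₂ e u, insert₂ e' v⟫_ℂ = ⟪e, e'⟫_ℂ * ⟪u, v⟫_ℂ :=
  inner_map_eq_of_pure₂ (fun x y x' y' => by
    rw [insert₂_pure₂, insert₂_pure₂, inner_pure₃, inner_pure₂]; ring) u v

theorem inner_insert₃ (e e' : G) (u v : HTensor E F) :
    ⟪insert₃ e u, insert₃ e' v⟫_ℂ = ⟪e, e'⟫_ℂ * ⟪u, v⟫_ℂ :=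
  inner_map_eq_of_pure₂ (fun x y x' y' => by
    rw [insert₃_pure₂, insert₃_pure₂, inner_pure₃, inner_pure₂]; ring) u v

theorem HilbertBasis.inner_mul_eq_ite {ι : Type*} [DecidableEq ι] (b : HilbertBasis ι ℂ E)
    (i j : ι) (c : ℂ) : ⟪b i, b j⟫_ℂ * c = if i = j then c else 0 := by
  rw [orthonormal_iff_ite.1 b.orthonormal]; split_ifs <;> simp

/-- With `y` and `z` fixed, `x ↦ ⟪v, x ⊗ y ⊗ z⟫` is a continuous functional vanishing on a Hilbert
basis. Hence `v` is orthogonal to all product vectors. -/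
theorem eq_zero_of_inner_insert₁ {ι : Type*} (b : HilbertBasis ι ℂ E) {v : HTensor₃ E F G}
    (h : ∀ i u, ⟪insert₁ (b i) u, v⟫_ℂ = 0) : v = 0 :=
  ext_inner_pure₃ fun x y z => by
    have : innerSL ℂ v ∘L pureCLM₃₁ y z = 0 := clm_ext_hilbertBasis b fun i => by
      have := h i (pure₂ y z)
      rw [insert₁_pure₂, inner_eq_zero_symm] at this
      simpa [pureCLM₃₁_apply] using this
    simpa [pureCLM₃₁_apply] using congrArg (fun f => f x) this

theorem eq_zero_of_inner_insert₂ {ι : Type*} (b : HilbertBasis ι ℂ F) {v : HTensor₃ E F G}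
    (h : ∀ i u, ⟪insert₂ (b i) u, v⟫_ℂ = 0) : v = 0 :=
  ext_inner_pure₃ fun x y z => by
    have : innerSL ℂ v ∘L pureCLM₃₂ x z = 0 := clm_ext_hilbertBasis b fun i => by
      have := h i (pure₂ x z)
      rw [insert₂_pure₂, inner_eq_zero_symm] at this
      simpa [pureCLM₃₂_apply] using this
    simpa [pureCLM₃₂_apply] using congrArg (fun f => f y) this

theorem eq_zero_of_inner_insert₃ {ι : Type*} (b : HilbertBasis ι ℂ G) {v : HTensor₃ E F G}
    (h : ∀ i u, ⟪insert₃ (b i) u, v⟫_ℂ = 0) : v = 0 :=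
  ext_inner_pure₃ fun x y z => by
    have : innerSL ℂ v ∘L pureCLM₃₃ x y = 0 := clm_ext_hilbertBasis b fun i => by
      have := h i (pure₂ x y)
      rw [insert₃_pure₂, inner_eq_zero_symm] at this
      simpa [pureCLM₃₃_apply] using this
    simpa [pureCLM₃₃_apply] using congrArg (fun f => f z) this

/-! ### Traces against the three partial traces, and positivity -/

theorem trace_partialTrace₁_comp [CompleteSpace E] {R : HTensor₃ E F G →L[ℂ] HTensor₃ E F G}
    (hR : IsTraceClass R) (B : F →L[ℂ] F) (C : G →L[ℂ] G) :
    trace (partialTrace₁ R ∘L tensorOp B C) = trace (R ∘L tensorOp₃ 1 B C) := by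
  classical
  exact hR.trace_tsum_comp
    (fun i j u v => by rw [inner_insert₁, HilbertBasis.inner_mul_eq_ite])
    (fun v => eq_zero_of_inner_insert₁ (onb E)) fun i => tensorOp₃_comp_insert₁ B C _

theorem trace_partialTrace₂_comp [CompleteSpace F] {R : HTensor₃ E F G →L[ℂ] HTensor₃ E F G}
    (hR : IsTraceClass R) (A : E →L[ℂ] E) (C : G →L[ℂ] G) :
    trace (partialTrace₂ R ∘L tensorOp A C) = trace (R ∘L tensorOp₃ A 1 C) := by
  classical
  exact hR.trace_tsum_comp
    (fun i j u v => by rw [inner_insert₂, HilbertBasis.inner_mul_eq_ite])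
    (fun v => eq_zero_of_inner_insert₂ (onb F)) fun i => tensorOp₃_comp_insert₂ A C _

theorem trace_partialTrace₃_comp [CompleteSpace G] {R : HTensor₃ E F G →L[ℂ] HTensor₃ E F G}
    (hR : IsTraceClass R) (A : E →L[ℂ] E) (B : F →L[ℂ] F) :
    trace (partialTrace₃ R ∘L tensorOp A B) = trace (R ∘L tensorOp₃ A B 1) := by
  classical
  exact hR.trace_tsum_comp
    (fun i j u v => by rw [inner_insert₃, HilbertBasis.inner_mul_eq_ite])
    (fun v => eq_zero_of_inner_insert₃ (onb G)) fun i => tensorOp₃_comp_insert₃ A B _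

/-- Product vectors of basis vectors form a Hilbert basis. -/
theorem exists_hilbertBasis_pure₂ [CompleteSpace E] [CompleteSpace F] {ι κ : Type*}
    (b : HilbertBasis ι ℂ E) (c : HilbertBasis κ ℂ F) :
    ∃ d : HilbertBasis (ι × κ) ℂ (HTensor E F), ∀ p, d p = pure₂ (b p.1) (c p.2) := by
  classical
  refine exists_hilbertBasis_of_inclusions (J := fun i => pureCLM₂ (b i)) (fun i j u v => ?_)
    (fun v h => ext_inner_pure₂ fun x y => ?_) c
  · rw [pureCLM₂_apply, pureCLM₂_apply, inner_pure₂, HilbertBasis.inner_mul_eq_ite]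
  · have : innerSL ℂ v ∘L pureFlipCLM₂ y = 0 := clm_ext_hilbertBasis b fun i => by
      have := h i y
      rw [pureCLM₂_apply, inner_eq_zero_symm] at this
      simpa [pureFlipCLM₂_apply] using this
    simpa [pureFlipCLM₂_apply] using congrArg (fun f => f x) this

theorem exists_hilbertBasis_pure₃ [CompleteSpace E] [CompleteSpace F] [CompleteSpace G]
    {ι κ μ : Type*} (b : HilbertBasis ι ℂ E) (c : HilbertBasis κ ℂ F) (d : HilbertBasis μ ℂ G) :
    ∃ f : HilbertBasis (ι × κ × μ) ℂ (HTensor₃ E F G),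
      ∀ p, f p = pure₃ (b p.1) (c p.2.1) (d p.2.2) := by
  classical
  obtain ⟨g, hg⟩ := exists_hilbertBasis_pure₂ c d
  obtain ⟨f, hf⟩ := exists_hilbertBasis_of_inclusions
    (J := fun i => insert₁ (G := G) (F := F) (b i))
    (fun i j u v => by rw [inner_insert₁, HilbertBasis.inner_mul_eq_ite])
    (fun v => eq_zero_of_inner_insert₁ b) g
  exact ⟨f, fun p => by rw [hf, hg, insert₁_pure₂]⟩

/-- Write `A = a* a`, `B = b* b`, `C = c* c` and cycle: the trace is that of `(a ⊗ b ⊗ c) R (a ⊗ b ⊗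
c)*`. In a product basis its diagonal entries are values of the quadratic form of `R` at product
vectors, where tensor-positivity applies. -/
theorem trace_comp_tensorOp₃_nonneg [CompleteSpace E] [CompleteSpace F] [CompleteSpace G]
    {R : HTensor₃ E F G →L[ℂ] HTensor₃ E F G} (hR : IsTraceClass R) (hpos : IsTensorPositive R)
    {A : E →L[ℂ] E} {B : F →L[ℂ] F} {C : G →L[ℂ] G} (hA : 0 ≤ A) (hB : 0 ≤ B) (hC : 0 ≤ C) :
    0 ≤ trace (R ∘L tensorOp₃ A B C) := by
  obtain ⟨a, rfl⟩ := CStarAlgebra.nonneg_iff_eq_star_mul_self.1 hA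
  obtain ⟨b, rfl⟩ := CStarAlgebra.nonneg_iff_eq_star_mul_self.1 hB
  obtain ⟨c, rfl⟩ := CStarAlgebra.nonneg_iff_eq_star_mul_self.1 hC
  obtain ⟨f, hf⟩ := exists_hilbertBasis_pure₃ (onb E) (onb F) (onb G)
  rw [tensorOp₃_mul, ← hR.trace_comp_comp]
  refine ((hR.comp_comp _ _).hasSum_trace f).nonneg fun p => ?_
  have hadj : tensorOp₃ a b c = (tensorOp₃ (star a) (star b) (star c)).adjoint := by
    simp [adjoint_tensorOp₃, ContinuousLinearMap.star_eq_adjoint]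
  rw [hadj, ContinuousLinearMap.comp_apply, ContinuousLinearMap.adjoint_inner_right,
    ContinuousLinearMap.comp_apply, hf, tensorOp₃_pure₃]
  exact hpos.2 _ _ _

end Density

/-! ### Observables satisfy `-1 ≤ A ≤ 1` -/

section Observable

variable {H : Type*} [NormedAddCommGroup H] [InnerProductSpace ℂ H] [CompleteSpace H]

theorem IsObservable.spectrum_real {A : H →L[ℂ] H} (hA : IsObservable A) {r : ℝ}
    (hr : r ∈ spectrum ℝ A) : r ∈ Set.Icc (-1 : ℝ) 1 := by
  obtain ⟨s, hs, h⟩ := hA.spectrum_subset (spectrum.algebraMap_mem ℂ hr)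
  have : s = r := Complex.ofReal_injective h
  exact this ▸ hs

theorem IsObservable.one_sub_nonneg {A : H →L[ℂ] H} (hA : IsObservable A) : 0 ≤ 1 - A := by
  have := (le_algebraMap_iff_spectrum_le (r := (1 : ℝ)) (a := A) hA.isSelfAdjoint).2
    fun x hx => (hA.spectrum_real hx).2
  rw [map_one] at this
  exact sub_nonneg.2 this

theorem IsObservable.one_add_nonneg {A : H →L[ℂ] H} (hA : IsObservable A) : 0 ≤ 1 + A := by
  have := (algebraMap_le_iff_le_spectrum (r := (-1 : ℝ)) (a := A) hA.isSelfAdjoint).2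
    fun x hx => (hA.spectrum_real hx).1
  rw [map_neg, map_one] at this
  exact neg_le_iff_add_nonneg'.1 this

end Observable

/-- Nonnegativity in `ℂ` includes being real, so `w + z` and `w - z` real makes both `w` and `z`
real. This is how the reality of `tr[ρ(B₁ ⊗ B₂)]` is obtained. -/
theorem norm_le_of_add_nonneg_of_sub_nonneg {z w : ℂ} (h₁ : 0 ≤ w + z) (h₂ : 0 ≤ w - z) :
    ((‖z‖ : ℝ) : ℂ) ≤ w := by
  rw [Complex.nonneg_iff] at h₁ h₂
  simp only [Complex.add_re, Complex.add_im, Complex.sub_re, Complex.sub_im] at h₁ h₂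
  have hz : z = (z.re : ℂ) := Complex.ext rfl (by simp; linarith)
  rw [Complex.le_def]
  refine ⟨?_, by simp; linarith⟩
  rw [hz, Complex.norm_real, Complex.ofReal_re, Real.norm_eq_abs, abs_le]
  constructor <;> linarith

end QBell

end

theorem theorem3 {H : Type*} [NormedAddCommGroup H] [InnerProductSpace ℂ H] [CompleteSpace H]
    [TopologicalSpace.SeparableSpace H]
    (ρ : QBell.HTensor H H →L[ℂ] QBell.HTensor H H)
    (hρ : QBell.IsDensityOperator ρ)
    (hR : ∃ R : QBell.HTensor₃ H H H →L[ℂ] QBell.HTensor₃ H H H,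
      IsSelfAdjoint R ∧ QBell.IsTraceClass R ∧ QBell.IsTensorPositive R ∧
      QBell.partialTrace₁ R = ρ ∧ QBell.partialTrace₂ R = ρ ∧ QBell.partialTrace₃ R = ρ)
    (A₁ B₁ B₂ : H →L[ℂ] H)
    (hA₁ : QBell.IsObservable A₁) (hB₁ : QBell.IsObservable B₁) (hB₂ : QBell.IsObservable B₂) :
    ((‖QBell.trace (ρ ∘L QBell.tensorOp A₁ B₁) - QBell.trace (ρ ∘L QBell.tensorOp A₁ B₂)‖ : ℝ) : ℂ)
      ≤ 1 - QBell.trace (ρ ∘L QBell.tensorOp B₁ B₂) := by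
  obtain ⟨R, -, htc, hpos, h1, h2, h3⟩ := hR
  have hone : QBell.trace (R ∘L QBell.tensorOp₃ 1 1 1) = 1 := by
    rw [← QBell.trace_partialTrace₁_comp htc, h1, ← hρ.trace_eq_one]
    congr 1
    exact QBell.clm_ext_pure₂ fun x y => by simp [QBell.tensorOp_pure₂]
  have e1 : QBell.trace (ρ ∘L QBell.tensorOp B₁ B₂) = _ :=
    h1 ▸ QBell.trace_partialTrace₁_comp htc B₁ B₂
  have e2 : QBell.trace (ρ ∘L QBell.tensorOp A₁ B₂) = _ :=
    h2 ▸ QBell.trace_partialTrace₂_comp htc A₁ B₂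
  have e3 : QBell.trace (ρ ∘L QBell.tensorOp A₁ B₁) = _ :=
    h3 ▸ QBell.trace_partialTrace₃_comp htc A₁ B₁
  -- Opposite sign patterns are paired, `p1` with `p2` and `p3` with `p4`, so odd-degree terms
  -- cancel; the second pair is the first with `A₁` negated.
  have p1 := QBell.trace_comp_tensorOp₃_nonneg htc hpos hA₁.one_add_nonneg hB₁.one_add_nonneg
    hB₂.one_sub_nonneg
  have p2 := QBell.trace_comp_tensorOp₃_nonneg htc hpos hA₁.one_sub_nonneg hB₁.one_sub_nonneg
    hB₂.one_add_nonneg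
  have p3 := QBell.trace_comp_tensorOp₃_nonneg htc hpos hA₁.one_sub_nonneg hB₁.one_add_nonneg
    hB₂.one_sub_nonneg
  have p4 := QBell.trace_comp_tensorOp₃_nonneg htc hpos hA₁.one_add_nonneg hB₁.one_sub_nonneg
    hB₂.one_add_nonneg
  simp only [QBell.tensorOp₃_add_left, QBell.tensorOp₃_sub_left, QBell.tensorOp₃_add_middle,
    QBell.tensorOp₃_sub_middle, QBell.tensorOp₃_add_right, QBell.tensorOp₃_sub_right,
    htc.trace_comp_add, htc.trace_comp_sub, hone] at p1 p2 p3 p4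
  -- Each pair sums to twice the expression wanted.
  have half : (0 : ℂ) ≤ 1 / 2 := by
    rw [Complex.nonneg_iff]; norm_num
  rw [e1, e2, e3]
  refine QBell.norm_le_of_add_nonneg_of_sub_nonneg ?_ ?_
  · convert! mul_nonneg half (add_nonneg p1 p2) using 1
    ring
  · convert! mul_nonneg half (add_nonneg p3 p4) using 1
    ring
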